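/- Let $M,T\ge 2$ be even integers with $T\ge M$, let $P=\frac{T-M}{2}+1$, let $N\ge 1$, and let $\mathcal A\subset\mathbb C$ be a finite signal constellation with at least two points. Let $\Theta$ be a complex $\frac M2\times\frac M2$ matrix. For information symbols $\mathbf s=(\mathbf s^i_p)$ with $\mathbf s^i_p\in\mathcal A^{M/2}$ ($i=1,2$; $p=1,\dots,P$) put $\mathbf X^i_p=\Theta\mathbf s^i_p$, and let $\mathbf C^i$ be the $\frac T2\times\frac M2$ matrix whose $(t,k)$ entry is the $k$-th entry of $\mathbf X^i_{t-k+1}$ if $1\le t-k+1\le P$, and $0$ otherwise. The Alamouti-block code $\mathbf B_{M,T,P}$ consists of the $T\times M$ codewords $$\mathbf B(\mathbf s)=\begin{bmatrix}\mathbf C^1&\mathbf C^2\\-(\mathbf C^2)^*&(\mathbf C^1)^*\end{bmatrix},$$ where ${}^*$ is entrywise complex conjugation. It is used over the block fading channel $\mathbf Y=\sqrt{\rho/\mu}\,\mathbf B(\mathbf s)\mathbf H+\mathbf W$ with $M$ transmit and $N$ receive antennas, where $\mathbf s$ is uniformly distributed, $\mathbf H$ ($M\times N$, known to the receiver) and $\mathbf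 W$ ($T\times N$) have i.i.d. $\mathcal{CN}(0,1)$ entries, $\mathbf s,\mathbf H,\mathbf W$ are independent, $\rho$ is the SNR and $\mu=\frac1T\,\mathbb E\|\mathbf B(\mathbf s)\|^2$ (Frobenius norm). An ML decoder returns a minimizer $\hat{\mathbf s}$ of $\|\mathbf Y-\sqrt{\rho/\mu}\,\mathbf B(\mathbf s)\mathbf H\|^2$ over all symbol vectors, ties being broken arbitrarily; let $P_e(\rho)=\Pr(\hat{\mathbf s}\ne\mathbf s)$. Assume that one of the following holds. (a) $\Theta$ has signal space diversity for $\mathcal A$: for all distinct $\mathbf u,\mathbf v\in\mathcal A^{M/2}$, no entry of $\Theta(\mathbf u-\mathbf v)$ is zero. (b) $\Theta$ is a cyclotomic rotation and $\mathcal A$ a matching constellation: there are positive integers $m,n$ with $\frac M2\,\varphi(m)\le\varphi(mn)$ and distinct integers $n_1=0,n_2,\dots,n_{M/2}$ with every $1+n_im$ coprime to $K=mn$ such that $\Theta_{i,j}=\zeta_K^{\,j(1+n_im)}$, where $\zeta_K=e^{2\pi\mathbf j/K}$, $\mathbf j=\sqrt{-1}$; and $\mathcal A\subset b+c\,\mathbb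 Z[\zeta_m]$ for some $b,c\in\mathbb C$ (for example QAM with $m=4$). Then $\mathbf B_{M,T,P}$ achieves full diversity under ML decoding: for every ML decoder $$\lim_{\rho\to\infty}\frac{-\log P_e(\rho)}{\log\rho}=MN,$$ and $\mathbf B(\mathbf s)-\mathbf B(\hat{\mathbf s})$ has rank $M$ for all $\mathbf s\ne\hat{\mathbf s}$. -/

import Mathlib

open Filter Topology MeasureTheory ProbabilityTheory

noncomputable section

namespace STBC

/-- The circularly symmetric complex Gaussian law `CN(0,1)`: real and imaginary parts are
independent real Gaussians with mean `0` and variance `1/2`. -/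
def complexGaussian : Measure ℂ :=
  ((gaussianReal 0 (1 / 2)).prod (gaussianReal 0 (1 / 2))).map
    (fun z : ℝ × ℝ => (⟨z.1, z.2⟩ : ℂ))

/-- The law of a random matrix with i.i.d. `CN(0,1)` entries. -/
def gaussianMatrix (ι κ : Type) [Fintype ι] [Fintype κ] : Measure (ι → κ → ℂ) :=
  Measure.pi fun _ => Measure.pi fun _ => complexGaussian

/-- The squared Frobenius norm. -/
def frobSq {ι κ : Type} [Fintype ι] [Fintype κ] (Z : Matrix ι κ ℂ) : ℝ :=
  ∑ i, ∑ j, ‖Z i j‖ ^ 2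

/-! Below, a space-time block code is the encoding map `X : S → Matrix τ α ℂ` from a finite set `S`
of messages to matrices whose rows are indexed by the symbol periods `τ` and whose columns are
indexed by the transmit antennas `α`. -/

/-- The normalization factor `μ`: the average over equiprobable messages of the energy transmitted
from all antennas during one symbol period. -/
def meanEnergy {S τ α : Type} [Fintype S] [Fintype τ] [Fintype α] (X : S → Matrix τ α ℂ) : ℝ :=
  (∑ s, frobSq (X s)) / (Fintype.card S * Fintype.card τ)

/-- The noiseless received matrix `√(ρ/μ) X(s) H`. -/
def faded {S τ α : Type} [Fintype S] [Fintype τ] [Fintype α] (X : S → Matrix τ α ℂ) {N : ℕ}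
    (ρ : ℝ) (H : Matrix α (Fin N) ℂ) (s : S) : Matrix τ (Fin N) ℂ :=
  ((√(ρ / meanEnergy X) : ℝ) : ℂ) • (X s * H)

/-- `δ` is a maximum-likelihood decoder at SNR `ρ`: from the known channel `H` and the received
matrix `Y` it returns a message minimizing `‖Y - √(ρ/μ) X(s) H‖²` (ties are broken arbitrarily). -/
def IsMLDecoder {S τ α : Type} [Fintype S] [Fintype τ] [Fintype α] (X : S → Matrix τ α ℂ) {N : ℕ}
    (ρ : ℝ) (δ : Matrix α (Fin N) ℂ → Matrix τ (Fin N) ℂ → S) : Prop :=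
  ∀ H Y s, frobSq (Y - faded X ρ H (δ H Y)) ≤ frobSq (Y - faded X ρ H s)

/-- The probability that `δ` decodes wrongly, for a uniformly distributed message `s` and a received
matrix `Y = √(ρ/μ) X(s) H + W`, where the channel `H` and the noise `W` have i.i.d. `CN(0,1)`
entries and `s`, `H`, `W` are independent. -/
def errorProb {S τ α : Type} [Fintype S] [Fintype τ] [Fintype α] (X : S → Matrix τ α ℂ) {N : ℕ}
    (ρ : ℝ) (δ : Matrix α (Fin N) ℂ → Matrix τ (Fin N) ℂ → S) : ℝ :=
  (∑ s, ((gaussianMatrix α (Fin N)).prod (gaussianMatrix τ (Fin N))).real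
    {z | δ (Matrix.of z.1) (faded X ρ (Matrix.of z.1) s + Matrix.of z.2) ≠ s}) / Fintype.card S

/-- With ML decoding and `N` receive antennas the code `X` has diversity order `d`, i.e. the error
probability decays like `ρ ^ (-d)` on the logarithmic scale as the SNR `ρ` tends to infinity. -/
def HasDiversityOrderML {S τ α : Type} [Fintype S] [Fintype τ] [Fintype α]
    (X : S → Matrix τ α ℂ) (N : ℕ) (d : ℝ) : Prop :=
  ∀ δ : ℝ → Matrix α (Fin N) ℂ → Matrix τ (Fin N) ℂ → S,
    (∀ ρ, 0 < ρ → IsMLDecoder X ρ (δ ρ)) →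
      Tendsto (fun ρ => -Real.log (errorProb X ρ (δ ρ)) / Real.log ρ) atTop (𝓝 d)

/-- The rank criterion: the difference of the codewords of any two distinct messages has full column
rank. -/
def FullRank {S τ α : Type} [Fintype α] (X : S → Matrix τ α ℂ) : Prop :=
  ∀ s s', s ≠ s' → (X s - X s').rank = Fintype.card α

/-- Full diversity under ML decoding with `N` receive antennas: the diversity order is the
number of transmit antennas times the number of receive antennas, and the rank criterion holds. -/
def FullDiversityML {S τ α : Type} [Fintype S] [Fintype τ] [Fintype α]
    (X : S → Matrix τ α ℂ) (N : ℕ) : Prop :=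
  HasDiversityOrderML X N (Fintype.card α * N) ∧ FullRank X

/-- The elementary `n × m` matrix with `P` diagonal layers: the layer `X p` starts in row `p` of the
first column and runs down diagonally (all indices start at `0`). -/
def layered (m n P : ℕ) (X : Fin P → Fin m → ℂ) : Matrix (Fin n) (Fin m) ℂ :=
  Matrix.of fun t k =>
    if h : k.val ≤ t.val ∧ t.val - k.val < P then X ⟨t.val - k.val, h.2⟩ k else 0

/-- The Alamouti-block code `B_{M,T,P}` with rotation matrix `Θ` and constellation `A`. The symbols
are arranged as `s i p k`: the `k`-th entry of the vector carried by the layer `p` of the `i`-th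
elementary matrix. -/
def alamoutiBlock (M T P : ℕ) (A : Finset ℂ) (Θ : Matrix (Fin (M / 2)) (Fin (M / 2)) ℂ)
    (s : Fin 2 → Fin P → Fin (M / 2) → A) :
    Matrix (Fin (T / 2) ⊕ Fin (T / 2)) (Fin (M / 2) ⊕ Fin (M / 2)) ℂ :=
  let C : Fin 2 → Matrix (Fin (T / 2)) (Fin (M / 2)) ℂ := fun i =>
    layered (M / 2) (T / 2) P fun p => Θ.mulVec fun k => (s i p k : ℂ)
  Matrix.fromBlocks (C 0) (C 1) (-(C 1).map star) ((C 0).map star)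

/-- Signal space diversity: rotating two distinct vectors of constellation symbols by `Θ` gives
vectors that differ in every coordinate. -/
def HasSignalSpaceDiversity {d : ℕ} (A : Finset ℂ) (Θ : Matrix (Fin d) (Fin d) ℂ) : Prop :=
  ∀ u v : Fin d → A, u ≠ v →
    ∀ j, Θ.mulVec (fun k => (u k : ℂ)) j ≠ Θ.mulVec (fun k => (v k : ℂ)) j

/-- `ζ_K = exp(2πi/K)`. -/
def zeta (K : ℕ) : ℂ := Complex.exp (2 * Real.pi * Complex.I / K)

/-- The cyclotomic `d × d` matrix whose row `i` is `ζ_K ^ (j (1 + ν_i m))`, `j = 1, …, d`, with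
`K = m n`. -/
def cyclotomicRotation (d m n : ℕ) (ν : Fin d → ℤ) : Matrix (Fin d) (Fin d) ℂ :=
  Matrix.of fun i j => zeta (m * n) ^ (((j.val : ℤ) + 1) * (1 + ν i * m))

/-- Admissible parameters of a cyclotomic matrix: `K = m n` with `d ≤ φ(K)/φ(m)`, the first `ν` is
`0`, the `ν` are distinct, and each `1 + ν_i m` is coprime to `K`. -/
structure CyclotomicParams (d m n : ℕ) (ν : Fin d → ℤ) : Prop where
  m_pos : 0 < m
  n_pos : 0 < n
  degree : d * Nat.totient m ≤ Nat.totient (m * n)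
  first : ∀ i : Fin d, i.val = 0 → ν i = 0
  distinct : Function.Injective ν
  coprime : ∀ i, IsCoprime (1 + ν i * m) ((m * n : ℕ) : ℤ)

/-- The constellation `A` is contained in a translated and scaled copy of the ring `ℤ[ζ_m]`
(for example QAM for `m = 4`). -/
def IsCyclotomicConstellation (m : ℕ) (A : Finset ℂ) : Prop :=
  ∃ b c : ℂ, ∀ a ∈ A, ∃ z ∈ Algebra.adjoin ℤ {zeta m}, a = b + c * z

end STBC

end

noncomputable section

namespace STBC

lemma gaussianPDFReal_half (x : ℝ) :
    gaussianPDFReal 0 (1 / 2) x = (√Real.pi)⁻¹ * Real.exp (-x ^ 2) := by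
  have h : (2 * Real.pi * ((1 / 2 : NNReal) : ℝ)) = Real.pi := by
    push_cast; ring
  have h' : (2 * ((1 / 2 : NNReal) : ℝ)) = 1 := by push_cast; ring
  rw [gaussianPDFReal, h, h', sub_zero, div_one]

lemma gaussianReal_half_Icc_le (r : ℝ) :
    gaussianReal 0 (1 / 2) (Set.Icc (-r) r) ≤ ENNReal.ofReal (2 * r) := by
  rw [gaussianReal_apply 0 (by norm_num)]
  calc ∫⁻ x in Set.Icc (-r) r, gaussianPDF 0 (1 / 2) x
      ≤ ∫⁻ _ in Set.Icc (-r) r, 1 := by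
        refine lintegral_mono fun x => ?_
        rw [gaussianPDF, gaussianPDFReal_half]
        refine ENNReal.ofReal_le_one.2 ?_
        refine mul_le_one₀ (inv_le_one_of_one_le₀ ?_) (Real.exp_pos _).le
          (Real.exp_le_one_iff.2 (by nlinarith [sq_nonneg x]))
        exact Real.one_le_sqrt.2 (by linarith [Real.pi_gt_three])
    _ = ENNReal.ofReal (2 * r) := by
        rw [setLIntegral_one, Real.volume_Icc]; congr 1; ring

lemma exists_le_gaussianReal_half_Ioo (a : ℝ) {ε : ℝ} (hε : 0 < ε) :
    ∃ c > 0, ∀ t : ℝ, 0 < t → t ≤ 1 → ENNReal.ofReal (c * t) ≤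
      gaussianReal 0 (1 / 2) (Set.Ioo (t * a - t * ε) (t * a + t * ε)) := by
  refine ⟨(√Real.pi)⁻¹ * Real.exp (-(|a| + ε) ^ 2) * (2 * ε), by positivity, fun t ht ht1 => ?_⟩
  rw [gaussianReal_apply 0 (by norm_num)]
  calc ENNReal.ofReal ((√Real.pi)⁻¹ * Real.exp (-(|a| + ε) ^ 2) * (2 * ε) * t)
      = ∫⁻ _ in Set.Ioo (t * a - t * ε) (t * a + t * ε),
          ENNReal.ofReal ((√Real.pi)⁻¹ * Real.exp (-(|a| + ε) ^ 2)) := by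
        rw [setLIntegral_const, Real.volume_Ioo, ← ENNReal.ofReal_mul (by positivity)]
        congr 1; ring
    _ ≤ _ := by
        refine setLIntegral_mono' measurableSet_Ioo fun x hx => ?_
        rw [gaussianPDF, gaussianPDFReal_half]
        refine ENNReal.ofReal_le_ofReal ?_
        have hx' : |x| ≤ |a| + ε := by
          have h1 : |x - t * a| ≤ t * ε := abs_le.2 ⟨by linarith [hx.1], by linarith [hx.2]⟩
          have h2 : |t * a| = t * |a| := by rw [abs_mul, abs_of_pos ht]
          have h3 : |x| ≤ |x - t * a| + |t * a| := by
            simpa using abs_add_le (x - t * a) (t * a)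
          nlinarith [abs_nonneg a]
        gcongr 2
        rw [← sq_abs x]
        have := abs_nonneg x
        gcongr

instance : IsProbabilityMeasure complexGaussian :=
  Measure.isProbabilityMeasure_map (by
    have : (fun z : ℝ × ℝ => (⟨z.1, z.2⟩ : ℂ)) = Complex.measurableEquivRealProd.symm := rfl
    rw [this]; exact Complex.measurableEquivRealProd.symm.measurable.aemeasurable)

instance (ι κ : Type) [Fintype ι] [Fintype κ] : IsProbabilityMeasure (gaussianMatrix ι κ) := by
  unfold gaussianMatrix; infer_instance

lemma complexGaussian_reProdIm (s t : Set ℝ) :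
    complexGaussian (s ×ℂ t) = gaussianReal 0 (1 / 2) s * gaussianReal 0 (1 / 2) t := by
  have : (fun z : ℝ × ℝ => (⟨z.1, z.2⟩ : ℂ)) = Complex.measurableEquivRealProd.symm := rfl
  rw [complexGaussian, this, MeasurableEquiv.map_apply, ← Measure.prod_prod]
  rfl

lemma complexGaussian_norm_le (r : ℝ) :
    complexGaussian {z | ‖z‖ ≤ r} ≤ ENNReal.ofReal (2 * r) ^ 2 := by
  calc complexGaussian {z | ‖z‖ ≤ r}
      ≤ complexGaussian (Set.Icc (-r) r ×ℂ Set.Icc (-r) r) := by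
        refine measure_mono fun z (hz : ‖z‖ ≤ r) => ?_
        exact ⟨abs_le.1 ((Complex.abs_re_le_norm z).trans hz),
          abs_le.1 ((Complex.abs_im_le_norm z).trans hz)⟩
    _ ≤ _ := by
        rw [complexGaussian_reProdIm, sq]
        gcongr <;> exact gaussianReal_half_Icc_le r

lemma exists_le_complexGaussian_ball (a : ℂ) {ε : ℝ} (hε : 0 < ε) :
    ∃ c > 0, ∀ t : ℝ, 0 < t → t ≤ 1 → ENNReal.ofReal (c * t ^ 2) ≤
      complexGaussian {z | ‖z - t * a‖ < t * ε} := by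
  obtain ⟨c₁, hc₁, h₁⟩ := exists_le_gaussianReal_half_Ioo a.re (half_pos hε)
  obtain ⟨c₂, hc₂, h₂⟩ := exists_le_gaussianReal_half_Ioo a.im (half_pos hε)
  refine ⟨c₁ * c₂, by positivity, fun t ht ht1 => ?_⟩
  calc ENNReal.ofReal (c₁ * c₂ * t ^ 2)
      = ENNReal.ofReal (c₁ * t) * ENNReal.ofReal (c₂ * t) := by
        rw [← ENNReal.ofReal_mul (by positivity)]; congr 1; ring
    _ ≤ _ := mul_le_mul' (h₁ t ht ht1) (h₂ t ht ht1)
    _ = _ := (complexGaussian_reProdIm _ _).symm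
    _ ≤ _ := by
        refine measure_mono fun z hz => ?_
        obtain ⟨⟨h1, h2⟩, h3, h4⟩ := hz
        have hre : |(z - t * a).re| < t * (ε / 2) := by
          rw [abs_lt]; constructor <;> simp <;> linarith
        have him : |(z - t * a).im| < t * (ε / 2) := by
          rw [abs_lt]; constructor <;> simp <;> linarith
        have := Complex.norm_le_abs_re_add_abs_im (z - t * a)
        simp only [Set.mem_ofPred_eq]
        linarith

lemma memLp_id_complexGaussian (p : ENNReal) (hp : p ≠ ⊤) : MemLp id p complexGaussian := by
  have hm : Measurable (fun z : ℝ × ℝ => (⟨z.1, z.2⟩ : ℂ)) :=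
    Complex.measurableEquivRealProd.symm.measurable
  have h := memLp_id_gaussianReal' (μ := 0) (v := 1 / 2) p hp
  have h1 : MemLp (fun z : ℝ × ℝ => z.1) p
      ((gaussianReal 0 (1 / 2)).prod (gaussianReal 0 (1 / 2))) :=
    h.comp_measurePreserving measurePreserving_fst
  have h2 : MemLp (fun z : ℝ × ℝ => z.2) p
      ((gaussianReal 0 (1 / 2)).prod (gaussianReal 0 (1 / 2))) :=
    h.comp_measurePreserving measurePreserving_snd
  have h3 : MemLp (fun z : ℝ × ℝ => (⟨z.1, z.2⟩ : ℂ)) p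
      ((gaussianReal 0 (1 / 2)).prod (gaussianReal 0 (1 / 2))) := by
    refine (h1.norm.add h2.norm).mono hm.aestronglyMeasurable (ae_of_all _ fun z => ?_)
    refine (Complex.norm_le_abs_re_add_abs_im _).trans (le_of_eq ?_)
    exact (abs_of_nonneg (add_nonneg (abs_nonneg z.1) (abs_nonneg z.2))).symm
  exact (memLp_map_measure_iff measurable_id.aestronglyMeasurable hm.aemeasurable).2 h3

section GaussianMatrix

variable {ι κ : Type} [Fintype ι] [Fintype κ]

lemma gaussianMatrix_box (s : ι → κ → Set ℂ) :
    gaussianMatrix ι κ {Z | ∀ i j, Z i j ∈ s i j} = ∏ i, ∏ j, complexGaussian (s i j) := by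
  have : {Z : ι → κ → ℂ | ∀ i j, Z i j ∈ s i j} =
      Set.univ.pi fun i => Set.univ.pi fun j => s i j := by
    ext Z; simp
  rw [this, gaussianMatrix, Measure.pi_pi]
  simp_rw [Measure.pi_pi]

lemma gaussianMatrix_norm_le (r : ℝ) :
    gaussianMatrix ι κ {Z | ∀ i j, ‖Z i j‖ ≤ r} ≤
      ENNReal.ofReal (2 * r) ^ (2 * (Fintype.card ι * Fintype.card κ)) := by
  refine (gaussianMatrix_box fun _ _ => {z | ‖z‖ ≤ r}).trans_le ?_
  calc ∏ _i : ι, ∏ _j : κ, complexGaussian {z | ‖z‖ ≤ r}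
      ≤ ∏ _i : ι, ∏ _j : κ, ENNReal.ofReal (2 * r) ^ 2 := by
        gcongr; exact complexGaussian_norm_le r
    _ = _ := by
        simp only [Finset.prod_const, Finset.card_univ, ← pow_mul]
        congr 1; ring

lemma exists_le_gaussianMatrix_ball (G : ι → κ → ℂ) {ε : ℝ} (hε : 0 < ε) :
    ∃ c > 0, ∀ t : ℝ, 0 < t → t ≤ 1 →
      ENNReal.ofReal (c * t ^ (2 * (Fintype.card ι * Fintype.card κ))) ≤
        gaussianMatrix ι κ {Z | ∀ i j, ‖Z i j - t * G i j‖ < t * ε} := by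
  choose c hc h using fun i j => exists_le_complexGaussian_ball (G i j) hε
  refine ⟨∏ i, ∏ j, c i j, by
    exact Finset.prod_pos fun i _ => Finset.prod_pos fun j _ => hc i j, fun t ht ht1 => ?_⟩
  refine le_of_le_of_eq ?_ (gaussianMatrix_box fun i j => {z | ‖z - t * G i j‖ < t * ε}).symm
  calc ENNReal.ofReal ((∏ i, ∏ j, c i j) * t ^ (2 * (Fintype.card ι * Fintype.card κ)))
      = ∏ i, ∏ j, ENNReal.ofReal (c i j * t ^ 2) := by
        have h0 : ∀ i j, 0 ≤ c i j * t ^ 2 := fun i j => mul_nonneg (hc i j).le (sq_nonneg t)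
        simp_rw [← ENNReal.ofReal_prod_of_nonneg fun j _ => h0 _ j]
        rw [← ENNReal.ofReal_prod_of_nonneg fun i _ => Finset.prod_nonneg fun j _ => h0 i j]
        congr 1
        simp only [Finset.prod_mul_distrib, Finset.prod_const, Finset.card_univ, ← pow_mul]
        congr 2; ring
    _ ≤ _ := Finset.prod_le_prod' fun i _ => Finset.prod_le_prod' fun j _ => h i j t ht ht1

lemma memLp_entry_gaussianMatrix (p : ENNReal) (hp : p ≠ ⊤) (i : ι) (j : κ) :
    MemLp (fun Z : ι → κ → ℂ => Z i j) p (gaussianMatrix ι κ) :=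
  ((memLp_id_complexGaussian p hp).comp_measurePreserving
    (measurePreserving_eval (fun _ : κ => complexGaussian) j)).comp_measurePreserving
    (measurePreserving_eval (fun _ : ι => Measure.pi fun _ : κ => complexGaussian) i)

lemma lintegral_sum_norm_pow_lt_top (k : ℕ) :
    ∫⁻ Z, ENNReal.ofReal (∑ i, ∑ j, ‖Z i j‖) ^ k ∂gaussianMatrix ι κ < ⊤ := by
  have hm : MemLp (fun Z : ι → κ → ℂ => ∑ i, ∑ j, ‖Z i j‖) (k : ENNReal) (gaussianMatrix ι κ) :=
    memLp_finsetSum _ fun i _ => memLp_finsetSum _ fun j _ =>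
      (memLp_entry_gaussianMatrix _ (ENNReal.natCast_ne_top k) i j).norm
  have hi := hm.integrable_norm_pow'
  refine lt_of_le_of_lt (lintegral_mono fun Z => ?_) hi.hasFiniteIntegral
  rw [← ofReal_norm, norm_pow, norm_norm, ENNReal.ofReal_pow (norm_nonneg _)]
  gcongr
  exact le_abs_self _

end GaussianMatrix

lemma zeta_isPrimitiveRoot {K : ℕ} (hK : 0 < K) : IsPrimitiveRoot (zeta K) K :=
  Complex.isPrimitiveRoot_exp K hK.ne'

open IntermediateField Polynomial in
/-- A primitive `K`-th root of unity has degree at least `φ(K)/φ(m)` over the field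
generated by a primitive `m`-th root of unity. -/
lemma totient_le_natDegree_mul {K m : ℕ} (hK : 0 < K) (hm : 0 < m) {ω η : ℂ}
    (hω : IsPrimitiveRoot ω K) (hη : IsPrimitiveRoot η m) :
    K.totient ≤ m.totient * (minpoly ℚ⟮η⟯ ω).natDegree := by
  have hωi : IsIntegral ℚ ω := (hω.isIntegral hK).tower_top
  have hηi : IsIntegral ℚ η := (hη.isIntegral hm).tower_top
  have d1 : Module.finrank ℚ ℚ⟮ω⟯ = K.totient := by
    rw [adjoin.finrank hωi, ← cyclotomic_eq_minpoly_rat hω hK, natDegree_cyclotomic]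
  have d2 : Module.finrank ℚ ℚ⟮η⟯ = m.totient := by
    rw [adjoin.finrank hηi, ← cyclotomic_eq_minpoly_rat hη hm, natDegree_cyclotomic]
  have hωi' : IsIntegral ℚ⟮η⟯ ω := hωi.tower_top
  have d3 := adjoin.finrank hωi'
  have key : Module.finrank ℚ ℚ⟮η⟯ * Module.finrank ℚ⟮η⟯ ℚ⟮η⟯⟮ω⟯ =
      Module.finrank ℚ ℚ⟮η⟯⟮ω⟯ := Module.finrank_mul_finrank ℚ ℚ⟮η⟯ ℚ⟮η⟯⟮ω⟯
  rw [← d1, ← d2, ← d3, key]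
  have : FiniteDimensional ℚ ℚ⟮η⟯ := adjoin.finiteDimensional hηi
  have : FiniteDimensional ℚ⟮η⟯ ℚ⟮η⟯⟮ω⟯ := adjoin.finiteDimensional hωi'
  have : FiniteDimensional ℚ ℚ⟮η⟯⟮ω⟯ := FiniteDimensional.trans ℚ ℚ⟮η⟯ ℚ⟮η⟯⟮ω⟯
  have hle : ℚ⟮ω⟯ ≤ (ℚ⟮η⟯⟮ω⟯).restrictScalars ℚ := by
    rw [adjoin_simple_le_iff, mem_restrictScalars]
    exact mem_adjoin_simple_self _ _
  exact LinearMap.finrank_le_finrank_of_injective (f := (inclusion hle).toLinearMap)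
    (inclusion_injective hle)

open IntermediateField Polynomial in
lemma eq_zero_of_sum_mul_pow_eq_zero {F : IntermediateField ℚ ℂ} {ω : ℂ} {d : ℕ}
    (hd : d ≤ (minpoly F ω).natDegree) (z : Fin d → F)
    (h : ∑ j, (z j : ℂ) * ω ^ (j : ℕ) = 0) : z = 0 := by
  set p : F[X] := ∑ j : Fin d, C (z j) * X ^ (j : ℕ) with hp
  have hroot : aeval ω p = 0 := by
    rw [← h, hp, map_sum]
    refine Finset.sum_congr rfl fun j _ => ?_
    simp [IntermediateField.algebraMap_apply]
  have hp0 : p = 0 := by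
    by_contra hne
    have h1 := minpoly.degree_le_of_ne_zero F ω hne hroot
    have h2 : p.degree < d := by
      rw [hp, ← mem_degreeLT]
      refine Submodule.sum_mem _ fun j _ => mem_degreeLT.2 ?_
      exact (degree_C_mul_X_pow_le _ _).trans_lt (by exact_mod_cast j.2)
    have h3 := natDegree_le_natDegree h1
    have h4 := (natDegree_lt_iff_degree_lt hne).2 h2
    omega
  funext j
  have hc : p.coeff (j : ℕ) = z j := by
    rw [hp, finsetSum_coeff, Finset.sum_eq_single j]
    · simp
    · intro i _ hij
      rw [coeff_C_mul_X_pow, if_neg fun h => hij (Fin.ext h.symm)]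
    · simp
  rw [← hc, hp0]; rfl

open IntermediateField in
theorem hasSignalSpaceDiversity_cyclotomicRotation {d m n : ℕ} {ν : Fin d → ℤ} {A : Finset ℂ}
    (h : CyclotomicParams d m n ν) (hA : IsCyclotomicConstellation m A) :
    HasSignalSpaceDiversity A (cyclotomicRotation d m n ν) := by
  obtain ⟨b, c, hA⟩ := hA
  intro u v huv i heq
  have hK : 0 < m * n := Nat.mul_pos h.m_pos h.n_pos
  set ω : ℂ := zeta (m * n) ^ (1 + ν i * m) with hωdef
  have hω : IsPrimitiveRoot ω (m * n) := by
    refine (zeta_isPrimitiveRoot hK).zpow_of_gcd_eq_one _ ?_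
    exact Int.isCoprime_iff_gcd_eq_one.1 (h.coprime i)
  have hη := zeta_isPrimitiveRoot h.m_pos
  have hdeg : d ≤ (minpoly ℚ⟮zeta m⟯ ω).natDegree := by
    have := totient_le_natDegree_mul hK h.m_pos hω hη
    refine le_of_mul_le_mul_left (a := m.totient) ?_ (Nat.totient_pos.2 h.m_pos)
    linarith [h.degree]
  have hF : ∀ z ∈ Algebra.adjoin ℤ {zeta m}, z ∈ ℚ⟮zeta m⟯ := by
    intro z hz
    induction hz using Algebra.adjoin_induction with
    | mem x hx => rw [Set.mem_singleton_iff.1 hx]; exact mem_adjoin_simple_self ℚ _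
    | algebraMap r => exact intCast_mem _ r
    | add x y _ _ hx hy => exact add_mem hx hy
    | mul x y _ _ hx hy => exact mul_mem hx hy
  choose z hz hzA using fun a : A => hA a a.2
  let w : Fin d → ℚ⟮zeta m⟯ := fun j => ⟨z (u j), hF _ (hz _)⟩ - ⟨z (v j), hF _ (hz _)⟩
  have hc : c ≠ 0 := by
    rintro rfl
    apply huv
    funext j
    apply Subtype.ext
    rw [hzA (u j), hzA (v j), zero_mul, zero_mul]
  have hω0 : ω ≠ 0 := hω.ne_zero hK.ne'
  have hsum : ∑ j, (w j : ℂ) * ω ^ (j : ℕ) = 0 := by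
    have h1 : c * ω * ∑ j, (w j : ℂ) * ω ^ (j : ℕ) = 0 := by
      rw [← sub_eq_zero.2 heq, Matrix.mulVec, Matrix.mulVec, dotProduct, dotProduct,
        ← Finset.sum_sub_distrib, Finset.mul_sum]
      refine Finset.sum_congr rfl fun j _ => ?_
      have he : cyclotomicRotation d m n ν i j = ω ^ ((j : ℕ) + 1) := by
        rw [cyclotomicRotation, Matrix.of_apply, hωdef, ← zpow_natCast, ← zpow_mul]
        congr 1; push_cast; ring
      rw [he, hzA (u j), hzA (v j)]
      simp only [w, AddSubgroupClass.coe_sub]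
      ring
    exact (mul_eq_zero.1 h1).resolve_left (mul_ne_zero hc hω0)
  have hw := eq_zero_of_sum_mul_pow_eq_zero hdeg w hsum
  apply huv
  funext j
  apply Subtype.ext
  have := congrArg (Subtype.val) (congrFun hw j)
  simp only [w, AddSubgroupClass.coe_sub, Pi.zero_apply, ZeroMemClass.coe_zero, sub_eq_zero] at this
  rw [hzA (u j), hzA (v j), this]

lemma rank_eq_card_iff_mulVec_injective {τ α : Type} [Fintype τ] [Fintype α]
    (D : Matrix τ α ℂ) : D.rank = Fintype.card α ↔ Function.Injective D.mulVec := by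
  have h := D.mulVecLin.finrank_range_add_finrank_ker
  rw [Module.finrank_fintype_fun_eq_card] at h
  change _ ↔ Function.Injective D.mulVecLin
  rw [← LinearMap.ker_eq_bot, ← Submodule.finrank_eq_zero]
  change Module.finrank ℂ (LinearMap.range D.mulVecLin) = _ ↔ _
  omega

lemma layered_sub (m n P : ℕ) (X Y : Fin P → Fin m → ℂ) :
    layered m n P X - layered m n P Y = layered m n P (X - Y) := by
  ext t k
  simp only [layered, Matrix.sub_apply, Matrix.of_apply]
  split_ifs <;> simp

/-- If the layers before `p` vanish, then row `p + k` of the layered matrix has nothing to the right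
of column `k`. -/
lemma layered_mulVec_apply {m n P : ℕ} {X : Fin P → Fin m → ℂ} {p : Fin P}
    (hX : ∀ q < p, X q = 0) {x : Fin m → ℂ} {k : Fin m} (hx : ∀ j < k, x j = 0)
    (hpk : p.val + k.val < n) :
    (layered m n P X).mulVec x ⟨p.val + k.val, hpk⟩ = X p k * x k := by
  rw [Matrix.mulVec, dotProduct, Finset.sum_eq_single k]
  · have : (k.val ≤ p.val + k.val ∧ p.val + k.val - k.val < P) := by
      have := p.2; omega
    simp only [layered, Matrix.of_apply, dif_pos this]
    congr 2
    apply Fin.ext; simp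
  · intro j _ hjk
    rcases lt_or_gt_of_ne hjk with h | h
    · rw [hx j h, mul_zero]
    · simp only [layered, Matrix.of_apply]
      split_ifs with hc
      · rw [hX ⟨_, hc.2⟩ (by rw [Fin.lt_def] at h ⊢; simp; omega)]; simp
      · simp
  · simp

lemma eq_zero_of_alamouti {a b x y : ℂ} (hab : a ≠ 0 ∨ b ≠ 0) (h₁ : a * x + b * y = 0)
    (h₂ : -(star b * x) + star a * y = 0) : x = 0 ∧ y = 0 := by
  have hdet : star a * a + star b * b ≠ 0 := by
    have h : star a * a + star b * b = ((‖a‖ ^ 2 + ‖b‖ ^ 2 : ℝ) : ℂ) := by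
      push_cast
      rw [← Complex.conj_mul', ← Complex.conj_mul']
      rfl
    rw [h, Complex.ofReal_ne_zero]
    rcases hab with h | h
    · have := norm_pos_iff.2 h; positivity
    · have := norm_pos_iff.2 h; positivity
  constructor
  · refine (mul_eq_zero.1 (?_ : (star a * a + star b * b) * x = 0)).resolve_left hdet
    linear_combination star a * h₁ - b * h₂
  · refine (mul_eq_zero.1 (?_ : (star a * a + star b * b) * y = 0)).resolve_left hdet
    linear_combination star b * h₁ + a * h₂

lemma alamouti_layered_mulVec_injective {m n P : ℕ} (hn : P + m ≤ n + 1)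
    {X Y : Fin P → Fin m → ℂ} {p : Fin P} (hX : ∀ q < p, X q = 0) (hY : ∀ q < p, Y q = 0)
    (hp : ∀ k, X p k ≠ 0 ∨ Y p k ≠ 0) :
    Function.Injective (Matrix.fromBlocks (layered m n P X) (layered m n P Y)
      (-(layered m n P Y).map star) ((layered m n P X).map star)).mulVec := by
  rw [← Matrix.coe_mulVecLin, injective_iff_map_eq_zero]
  intro v hv
  rw [Matrix.mulVecLin_apply, Matrix.fromBlocks_mulVec] at hv
  set x := v ∘ Sum.inl
  set y := v ∘ Sum.inr
  have hstar : ∀ Z : Fin P → Fin m → ℂ,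
      (layered m n P Z).map star = layered m n P (fun q k => star (Z q k)) := by
    intro Z
    ext t k
    simp only [layered, Matrix.map_apply, Matrix.of_apply]
    split_ifs <;> simp
  have key : ∀ k : Fin m, x k = 0 ∧ y k = 0 := by
    intro k
    induction k using WellFoundedLT.induction with
    | ind k ih =>
      have hpk : p.val + k.val < n := by have := p.2; have := k.2; omega
      have e1 := congrFun hv (Sum.inl ⟨p.val + k.val, hpk⟩)
      have e2 := congrFun hv (Sum.inr ⟨p.val + k.val, hpk⟩)
      simp only [Sum.elim_inl, Sum.elim_inr, Pi.add_apply, Pi.zero_apply, hstar,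
        Matrix.neg_mulVec, Pi.neg_apply] at e1 e2
      rw [layered_mulVec_apply hX (fun j hj => (ih j hj).1),
        layered_mulVec_apply hY (fun j hj => (ih j hj).2)] at e1
      rw [layered_mulVec_apply (p := p) (fun q hq => by rw [hY q hq]; ext; simp)
          (fun j hj => (ih j hj).1),
        layered_mulVec_apply (p := p) (fun q hq => by rw [hX q hq]; ext; simp)
          (fun j hj => (ih j hj).2)] at e2
      exact eq_zero_of_alamouti (hp k) e1 e2
  funext i
  rcases i with k | k
  · exact (key k).1
  · exact (key k).2

theorem fullRank_alamoutiBlock {M T P : ℕ} (h : P + M / 2 ≤ T / 2 + 1) {A : Finset ℂ}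
    {Θ : Matrix (Fin (M / 2)) (Fin (M / 2)) ℂ} (hΘ : HasSignalSpaceDiversity A Θ) :
    FullRank (alamoutiBlock M T P A Θ) := by
  intro s s' hss
  let L : (Fin 2 → Fin P → Fin (M / 2) → A) → Fin 2 → Fin P → Fin (M / 2) → ℂ :=
    fun s i p => Θ.mulVec fun k => (s i p k : ℂ)
  have hL : ∀ i q, s i q ≠ s' i q → ∀ k, (L s i - L s' i) q k ≠ 0 :=
    fun i q hq k => sub_ne_zero.2 (hΘ _ _ hq k)
  have hL0 : ∀ i q, s i q = s' i q → (L s i - L s' i) q = 0 := by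
    intro i q hq
    simp only [L, Pi.sub_apply, hq, sub_self]
  have hdiff : alamoutiBlock M T P A Θ s - alamoutiBlock M T P A Θ s' =
      Matrix.fromBlocks (layered (M / 2) (T / 2) P (L s 0 - L s' 0))
        (layered (M / 2) (T / 2) P (L s 1 - L s' 1))
        (-(layered (M / 2) (T / 2) P (L s 1 - L s' 1)).map star)
        ((layered (M / 2) (T / 2) P (L s 0 - L s' 0)).map star) := by
    simp only [← layered_sub]
    ext (i | i) (j | j) <;> (simp [alamoutiBlock, L]; try ring)
  rw [hdiff, rank_eq_card_iff_mulVec_injective]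
  classical
  have hex : ∃ q, ∃ i, s i q ≠ s' i q := by
    by_contra! hcon
    exact hss (funext fun i => funext fun q => hcon q i)
  let F : Finset (Fin P) := Finset.univ.filter fun q => ∃ i, s i q ≠ s' i q
  have hF : F.Nonempty := hex.imp fun q hq => by simpa [F] using hq
  have hmem : ∃ i, s i (F.min' hF) ≠ s' i (F.min' hF) := by
    simpa [F] using F.min'_mem hF
  have hmin : ∀ q < F.min' hF, ∀ i, s i q = s' i q := by
    intro q hq i
    by_contra hne
    exact absurd (F.min'_le q (Finset.mem_filter.2 ⟨Finset.mem_univ q, i, hne⟩)) (not_le.2 hq)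
  refine alamouti_layered_mulVec_injective h (p := F.min' hF)
    (fun q hq => hL0 0 q (hmin q hq 0)) (fun q hq => hL0 1 q (hmin q hq 1)) fun k => ?_
  obtain ⟨i, hi⟩ := hmem
  fin_cases i
  · exact Or.inl (hL 0 _ hi k)
  · exact Or.inr (hL 1 _ hi k)

section Frobenius

variable {ι κ α : Type} [Fintype ι] [Fintype κ] [Fintype α]

lemma frobSq_nonneg (Z : Matrix ι κ ℂ) : 0 ≤ frobSq Z :=
  Finset.sum_nonneg fun _ _ => Finset.sum_nonneg fun _ _ => sq_nonneg _

lemma norm_sq_le_frobSq (Z : Matrix ι κ ℂ) (i : ι) (j : κ) : ‖Z i j‖ ^ 2 ≤ frobSq Z :=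
  (Finset.single_le_sum (f := fun j => ‖Z i j‖ ^ 2) (fun _ _ => sq_nonneg _)
    (Finset.mem_univ j)).trans
    (Finset.single_le_sum (f := fun i => ∑ j, ‖Z i j‖ ^ 2)
      (fun _ _ => Finset.sum_nonneg fun _ _ => sq_nonneg _) (Finset.mem_univ i))

lemma norm_le_sum_norm (Z : Matrix ι κ ℂ) (i : ι) (j : κ) : ‖Z i j‖ ≤ ∑ i, ∑ j, ‖Z i j‖ :=
  (Finset.single_le_sum (f := fun j => ‖Z i j‖) (fun _ _ => norm_nonneg _)
    (Finset.mem_univ j)).trans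
    (Finset.single_le_sum (f := fun i => ∑ j, ‖Z i j‖)
      (fun _ _ => Finset.sum_nonneg fun _ _ => norm_nonneg _) (Finset.mem_univ i))

lemma frobSq_pos {Z : Matrix ι κ ℂ} (hZ : Z ≠ 0) : 0 < frobSq Z := by
  by_contra h
  apply hZ
  ext i j
  have h1 := norm_sq_le_frobSq Z i j
  have h2 : ‖Z i j‖ = 0 := by nlinarith [norm_nonneg (Z i j)]
  simpa using h2

lemma frobSq_le_sq_sum_norm (Z : Matrix ι κ ℂ) : frobSq Z ≤ (∑ i, ∑ j, ‖Z i j‖) ^ 2 := by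
  rw [sq, frobSq, Finset.sum_mul]
  simp_rw [Finset.sum_mul]
  refine Finset.sum_le_sum fun i _ => Finset.sum_le_sum fun j _ => ?_
  rw [sq]
  exact mul_le_mul_of_nonneg_left (norm_le_sum_norm Z i j) (norm_nonneg _)

lemma norm_le_of_frobSq_add_le {W V : Matrix ι κ ℂ} (h : frobSq (W + V) ≤ frobSq W) (i : ι)
    (j : κ) : ‖V i j‖ ≤ 2 * ∑ i, ∑ j, ‖W i j‖ := by
  have hV : frobSq V ≤ 2 * frobSq (W + V) + 2 * frobSq W := by
    simp only [frobSq, Finset.mul_sum, ← Finset.sum_add_distrib]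
    refine Finset.sum_le_sum fun i _ => Finset.sum_le_sum fun j _ => ?_
    have h1 : ‖V i j‖ ≤ ‖(W + V) i j‖ + ‖W i j‖ := by
      simpa using norm_sub_le ((W + V) i j) (W i j)
    nlinarith [norm_nonneg (V i j), sq_nonneg (‖(W + V) i j‖ - ‖W i j‖)]
  have h0 : 0 ≤ ∑ i, ∑ j, ‖W i j‖ :=
    Finset.sum_nonneg fun _ _ => Finset.sum_nonneg fun _ _ => norm_nonneg _
  refine abs_le_of_sq_le_sq' ?_ (by positivity) |>.2
  linarith [norm_sq_le_frobSq V i j, frobSq_le_sq_sum_norm W]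

lemma norm_le_of_norm_mul_le {ι κ α : Type} [Fintype ι] [Fintype α] [DecidableEq α]
    {L : Matrix α ι ℂ} {D : Matrix ι α ℂ} (hL : L * D = 1) {H : Matrix α κ ℂ} {R : ℝ}
    (hR : ∀ i j, ‖(D * H) i j‖ ≤ R) (hR0 : 0 ≤ R) (a : α) (j : κ) :
    ‖H a j‖ ≤ (∑ a, ∑ i, ‖L a i‖) * R := by
  have hH : H = L * (D * H) := by rw [← Matrix.mul_assoc, hL, Matrix.one_mul]
  calc ‖H a j‖ = ‖∑ i, L a i * (D * H) i j‖ := by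
        conv_lhs => rw [hH, Matrix.mul_apply]
    _ ≤ ∑ i, ‖L a i‖ * R := by
        refine (norm_sum_le _ _).trans (Finset.sum_le_sum fun i _ => ?_)
        rw [norm_mul]
        exact mul_le_mul_of_nonneg_left (hR i j) (norm_nonneg _)
    _ ≤ _ := by
        rw [← Finset.sum_mul]
        refine mul_le_mul_of_nonneg_right ?_ hR0
        exact Finset.single_le_sum (f := fun a => ∑ i, ‖L a i‖)
          (fun _ _ => Finset.sum_nonneg fun _ _ => norm_nonneg _) (Finset.mem_univ a)

lemma exists_left_inverse_of_rank [DecidableEq α] {D : Matrix ι α ℂ}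
    (h : D.rank = Fintype.card α) : ∃ L : Matrix α ι ℂ, L * D = 1 := by
  classical
  have hinj := (rank_eq_card_iff_mulVec_injective D).1 h
  obtain ⟨g, hg⟩ := D.mulVecLin.exists_leftInverse_of_injective (LinearMap.ker_eq_bot.2 hinj)
  refine ⟨LinearMap.toMatrix' g, ?_⟩
  have : LinearMap.toMatrix' (g ∘ₗ D.mulVecLin) = 1 := by rw [hg, LinearMap.toMatrix'_id]
  rw [LinearMap.toMatrix'_comp] at this
  rwa [← Matrix.toLin'_apply', LinearMap.toMatrix'_toLin'] at this

end Frobenius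

lemma tendsto_neg_log_div_log {f : ℝ → ℝ} {d c K : ℝ} (hc : 0 < c)
    (hl : ∀ᶠ ρ in atTop, c * ρ ^ (-d) ≤ f ρ) (hu : ∀ᶠ ρ in atTop, f ρ ≤ K * ρ ^ (-d)) :
    Tendsto (fun ρ => -Real.log (f ρ) / Real.log ρ) atTop (𝓝 d) := by
  have hlim : ∀ a : ℝ, Tendsto (fun ρ => d - Real.log a / Real.log ρ) atTop (𝓝 d) := by
    intro a
    simpa using tendsto_const_nhds.sub (Real.tendsto_log_atTop.const_div_atTop (Real.log a))
  refine tendsto_of_tendsto_of_tendsto_of_le_of_le' (hlim K) (hlim c) ?_ ?_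
  · filter_upwards [hl, hu, eventually_gt_atTop 1] with ρ h1 h2 hρ
    have hρ0 : 0 < ρ := by linarith
    have hlog : 0 < Real.log ρ := Real.log_pos hρ
    have hpow : 0 < ρ ^ (-d) := Real.rpow_pos_of_pos hρ0 _
    have hf : 0 < f ρ := lt_of_lt_of_le (by positivity) h1
    have hK : 0 < K := pos_of_mul_pos_left (hf.trans_le h2) hpow.le
    have := Real.log_le_log hf h2
    rw [Real.log_mul hK.ne' hpow.ne', Real.log_rpow hρ0] at this
    rw [le_div_iff₀ hlog, sub_mul, div_mul_cancel₀ _ hlog.ne']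
    linarith
  · filter_upwards [hl, eventually_gt_atTop 1] with ρ h1 hρ
    have hρ0 : 0 < ρ := by linarith
    have hlog : 0 < Real.log ρ := Real.log_pos hρ
    have hpow : 0 < ρ ^ (-d) := Real.rpow_pos_of_pos hρ0 _
    have := Real.log_le_log (by positivity) h1
    rw [Real.log_mul hc.ne' hpow.ne', Real.log_rpow hρ0] at this
    rw [div_le_iff₀ hlog, sub_mul, div_mul_cancel₀ _ hlog.ne']
    linarith

lemma sq_inv_sqrt_pow {ρ : ℝ} (hρ : 0 < ρ) (d : ℕ) : (1 / √ρ) ^ (2 * d) = ρ ^ (-(d : ℝ)) := by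
  rw [pow_mul, div_pow, one_pow, Real.sq_sqrt hρ.le, Real.rpow_neg hρ.le, Real.rpow_natCast,
    one_div, inv_pow]

/-- For independent Gaussian matrices `H` and `W`, the probability that `H` is entrywise smaller
than `C ‖W‖ / √ρ` is at most of order `ρ ^ (-d)`, with `d` the number of entries of `H`. -/
lemma exists_gaussian_prod_le {ι κ τ β : Type} [Fintype ι] [Fintype κ] [Fintype τ] [Fintype β]
    {C : ℝ} (hC : 0 ≤ C) : ∃ K : ℝ, ∀ ρ : ℝ, 0 < ρ →
      ((gaussianMatrix ι κ).prod (gaussianMatrix τ β)).real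
        {z | ∀ i j, ‖z.1 i j‖ ≤ C * (1 / √ρ) * ∑ t, ∑ b, ‖z.2 t b‖} ≤
      K * ρ ^ (-((Fintype.card ι * Fintype.card κ : ℕ) : ℝ)) := by
  set d := Fintype.card ι * Fintype.card κ
  set I := ∫⁻ Z, ENNReal.ofReal (∑ t, ∑ b, ‖Z t b‖) ^ (2 * d) ∂gaussianMatrix τ β with hI
  have hItop : I ≠ ⊤ := (lintegral_sum_norm_pow_lt_top (2 * d)).ne
  refine ⟨(2 * C) ^ (2 * d) * I.toReal, fun ρ hρ => ?_⟩
  have hmeas : MeasurableSet {z : (ι → κ → ℂ) × (τ → β → ℂ) |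
      ∀ i j, ‖z.1 i j‖ ≤ C * (1 / √ρ) * ∑ t, ∑ b, ‖z.2 t b‖} := by
    refine IsClosed.measurableSet ?_
    simp only [Set.ofPred_forall]
    exact isClosed_iInter fun i => isClosed_iInter fun j =>
      isClosed_le (by fun_prop) (by fun_prop)
  have hle : ((gaussianMatrix ι κ).prod (gaussianMatrix τ β))
      {z | ∀ i j, ‖z.1 i j‖ ≤ C * (1 / √ρ) * ∑ t, ∑ b, ‖z.2 t b‖} ≤
      ENNReal.ofReal (2 * C * (1 / √ρ)) ^ (2 * d) * I := by
    rw [Measure.prod_apply_symm hmeas, hI, ← lintegral_const_mul _ (by fun_prop)]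
    refine lintegral_mono fun W => ?_
    refine (gaussianMatrix_norm_le (C * (1 / √ρ) * ∑ t, ∑ b, ‖W t b‖)).trans ?_
    rw [← mul_assoc, ← mul_assoc, ENNReal.ofReal_mul (by positivity), mul_pow]
  refine (ENNReal.toReal_mono (ENNReal.mul_ne_top
    (ENNReal.pow_ne_top ENNReal.ofReal_ne_top) hItop) hle).trans ?_
  rw [ENNReal.toReal_mul, ENNReal.toReal_pow, ENNReal.toReal_ofReal (by positivity), mul_pow,
    sq_inv_sqrt_pow hρ]
  exact le_of_eq (by ring)

section Code

variable {S τ α : Type} [Fintype S] [Fintype τ] [Fintype α] {X : S → Matrix τ α ℂ} {N : ℕ}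

lemma faded_add_sub_faded (ρ : ℝ) (H : Matrix α (Fin N) ℂ) (W : Matrix τ (Fin N) ℂ) (s s' : S) :
    faded X ρ H s + W - faded X ρ H s' =
      W + ((√(ρ / meanEnergy X) : ℝ) : ℂ) • ((X s - X s') * H) := by
  rw [faded, faded, Matrix.sub_mul, smul_sub]
  abel

lemma meanEnergy_pos [Nonempty α] [Nontrivial S] (hX : FullRank X) : 0 < meanEnergy X := by
  obtain ⟨s, s', hss⟩ := exists_pair_ne S
  have hne : X s ≠ 0 ∨ X s' ≠ 0 := by
    by_contra! h
    have := hX s s' hss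
    rw [h.1, h.2, sub_zero, Matrix.rank_zero] at this
    exact Fintype.card_ne_zero this.symm
  obtain ⟨u, hu⟩ : ∃ u, X u ≠ 0 := hne.elim (fun h => ⟨s, h⟩) fun h => ⟨s', h⟩
  have hτ : Nonempty τ := by
    by_contra h
    rw [not_nonempty_iff] at h
    exact hu (Matrix.ext fun i => (h.false i).elim)
  have hsum : 0 < ∑ s, frobSq (X s) :=
    Finset.sum_pos' (fun s _ => frobSq_nonneg _) ⟨u, Finset.mem_univ u, frobSq_pos hu⟩
  have h1 : 0 < Fintype.card S := Fintype.card_pos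
  have h2 : 0 < Fintype.card τ := Fintype.card_pos
  unfold meanEnergy
  positivity

theorem exists_errorProb_le [Nonempty α] [Nontrivial S] (hX : FullRank X) :
    ∃ K : ℝ, ∀ ρ > 0, ∀ δ : Matrix α (Fin N) ℂ → Matrix τ (Fin N) ℂ → S, IsMLDecoder X ρ δ →
      errorProb X ρ δ ≤ K * ρ ^ (-((Fintype.card α * Fintype.card (Fin N) : ℕ) : ℝ)) := by
  classical
  have hμ := meanEnergy_pos hX
  choose L hL using fun p : {p : S × S // p.1 ≠ p.2} =>
    exists_left_inverse_of_rank (hX p.1.1 p.1.2 p.2)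
  have hLnn : ∀ p, 0 ≤ ∑ a, ∑ i, ‖L p a i‖ := fun p =>
    Finset.sum_nonneg fun _ _ => Finset.sum_nonneg fun _ _ => norm_nonneg _
  set B := ∑ p, ∑ a, ∑ i, ‖L p a i‖ with hB
  have hB0 : 0 ≤ B := Finset.sum_nonneg fun p _ => hLnn p
  set C := B * (2 * √(meanEnergy X)) with hC
  have hC0 : 0 ≤ C := by positivity
  obtain ⟨K, hK⟩ := exists_gaussian_prod_le (ι := α) (κ := Fin N) (τ := τ) (β := Fin N) hC0
  refine ⟨K, fun ρ hρ δ hδ => ?_⟩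
  have hcard : (0 : ℝ) < Fintype.card S := by exact_mod_cast Fintype.card_pos
  rw [errorProb, div_le_iff₀ hcard]
  refine (Finset.sum_le_sum fun s _ => (measureReal_mono ?_).trans (hK ρ hρ)).trans
    (le_of_eq (by rw [Finset.sum_const, Finset.card_univ, nsmul_eq_mul, mul_comm]))
  rintro ⟨H, W⟩ (hz : δ (Matrix.of H) (faded X ρ (Matrix.of H) s + Matrix.of W) ≠ s)
  set Y := faded X ρ (Matrix.of H) s + Matrix.of W with hY
  have hml := hδ (Matrix.of H) Y s
  rw [hY, faded_add_sub_faded, ← hY, add_sub_cancel_left] at hml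
  set s' := δ (Matrix.of H) Y
  have hk : 0 < √(ρ / meanEnergy X) := Real.sqrt_pos.2 (by positivity)
  set S₀ := ∑ t, ∑ b, ‖W t b‖
  have hS₀ : 0 ≤ S₀ := Finset.sum_nonneg fun _ _ => Finset.sum_nonneg fun _ _ => norm_nonneg _
  have hD : ∀ t b, ‖((X s - X s') * Matrix.of H) t b‖ ≤ 2 * S₀ / √(ρ / meanEnergy X) := by
    intro t b
    have := norm_le_of_frobSq_add_le hml t b
    rw [Matrix.smul_apply, smul_eq_mul, norm_mul, Complex.norm_real,
      Real.norm_of_nonneg hk.le] at this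
    rw [le_div_iff₀ hk, mul_comm]
    exact this
  intro a b
  refine (norm_le_of_norm_mul_le (hL ⟨(s, s'), hz.symm⟩) hD (by positivity) a b).trans ?_
  calc _ ≤ B * (2 * S₀ / √(ρ / meanEnergy X)) := by
        refine mul_le_mul_of_nonneg_right ?_ (by positivity)
        exact Finset.single_le_sum (f := fun p => ∑ a, ∑ i, ‖L p a i‖) (fun p _ => hLnn p)
          (Finset.mem_univ _)
    _ = C * (1 / √ρ) * S₀ := by
        rw [hC, Real.sqrt_div hρ.le]
        have := Real.sqrt_pos.2 hρ
        have := Real.sqrt_pos.2 hμ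
        field_simp

/-- For a nonzero codeword difference `D`, the noise `W` is farther from `0` than from `-D H` on a
product of neighbourhoods of a channel matrix and a noise matrix. -/
lemma exists_ball_frobSq_lt (hN : 0 < N) {D : Matrix τ α ℂ} (hD : D ≠ 0) :
    ∃ (G : α → Fin N → ℂ) (V : τ → Fin N → ℂ) (ε : ℝ), 0 < ε ∧
      ∀ (H : α → Fin N → ℂ) (W : τ → Fin N → ℂ), (∀ i j, ‖H i j - G i j‖ < ε) →
        (∀ i j, ‖W i j - V i j‖ < ε) →
          frobSq (Matrix.of W + D * Matrix.of H) < frobSq (Matrix.of W) := by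
  classical
  obtain ⟨t, a, hta⟩ : ∃ t a, D t a ≠ 0 := by
    by_contra! h
    exact hD (Matrix.ext h)
  let G : α → Fin N → ℂ := fun i _ => if i = a then 1 else 0
  let V : τ → Fin N → ℂ := -(D * Matrix.of G)
  have hV : Matrix.of V ≠ 0 := by
    intro h
    have h1 : -(D * Matrix.of G) t ⟨0, hN⟩ = 0 := congrFun (congrFun h t) ⟨0, hN⟩
    simp only [G, Matrix.mul_apply, Matrix.of_apply, mul_ite, mul_one, mul_zero,
      Finset.sum_ite_eq', Finset.mem_univ, if_true, neg_eq_zero] at h1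
    exact hta h1
  let O : Set ((α → Fin N → ℂ) × (τ → Fin N → ℂ)) :=
    {z | frobSq (Matrix.of z.2 + D * Matrix.of z.1) < frobSq (Matrix.of z.2)}
  have hO : IsOpen O := by
    refine isOpen_lt ?_ ?_
    · simp only [frobSq, Matrix.add_apply, Matrix.mul_apply, Matrix.of_apply]
      fun_prop
    · simp only [frobSq, Matrix.of_apply]
      fun_prop
  have hmem : (G, V) ∈ O := by
    have h0 : Matrix.of V + D * Matrix.of G = 0 := by
      change -(D * Matrix.of G) + D * Matrix.of G = 0
      exact neg_add_cancel _
    change frobSq (Matrix.of V + D * Matrix.of G) < frobSq (Matrix.of V)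
    rw [h0]
    refine lt_of_eq_of_lt ?_ (frobSq_pos hV)
    simp [frobSq]
  obtain ⟨ε, hε, hball⟩ := Metric.isOpen_iff.1 hO _ hmem
  refine ⟨G, V, ε, hε, fun H W hH hW => ?_⟩
  refine hball (a := (H, W)) ?_
  rw [Metric.mem_ball, Prod.dist_eq, max_lt_iff]
  constructor
  · exact (dist_pi_lt_iff hε).2 fun i => (dist_pi_lt_iff hε).2 fun j => by
      rw [dist_eq_norm]; exact hH i j
  · exact (dist_pi_lt_iff hε).2 fun i => (dist_pi_lt_iff hε).2 fun j => by
      rw [dist_eq_norm]; exact hW i j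

theorem exists_le_errorProb [Nonempty α] [Nontrivial S] (hN : 0 < N) (hX : FullRank X) :
    ∃ c > 0, ∀ ρ ≥ 1, ∀ δ : Matrix α (Fin N) ℂ → Matrix τ (Fin N) ℂ → S, IsMLDecoder X ρ δ →
      c * ρ ^ (-((Fintype.card α * Fintype.card (Fin N) : ℕ) : ℝ)) ≤ errorProb X ρ δ := by
  have hμ := meanEnergy_pos hX
  obtain ⟨s, s', hss⟩ := exists_pair_ne S
  set D : Matrix τ α ℂ := ((1 / √(meanEnergy X) : ℝ) : ℂ) • (X s - X s') with hDdef
  have hD : D ≠ 0 := by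
    refine smul_ne_zero (Complex.ofReal_ne_zero.2 (by positivity)) fun h => ?_
    have := hX s s' hss
    rw [h, Matrix.rank_zero] at this
    exact Fintype.card_ne_zero this.symm
  obtain ⟨G, V, ε, hε, hball⟩ := exists_ball_frobSq_lt hN hD
  obtain ⟨c₁, hc₁, h₁⟩ := exists_le_gaussianMatrix_ball G hε
  obtain ⟨c₂, hc₂, h₂⟩ := exists_le_gaussianMatrix_ball V hε
  have hcard : (0 : ℝ) < Fintype.card S := by exact_mod_cast Fintype.card_pos
  refine ⟨c₁ * c₂ / Fintype.card S, by positivity, fun ρ hρ δ hδ => ?_⟩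
  have hρ0 : 0 < ρ := by linarith
  have hsq : 0 < √ρ := Real.sqrt_pos.2 hρ0
  have ht1 : 1 / √ρ ≤ 1 := by
    rw [div_le_one hsq]; exact Real.one_le_sqrt.2 hρ
  have hsub : {H : α → Fin N → ℂ | ∀ i j, ‖H i j - (1 / √ρ : ℝ) * G i j‖ < 1 / √ρ * ε} ×ˢ
      {W : τ → Fin N → ℂ | ∀ i j, ‖W i j - (1 : ℝ) * V i j‖ < 1 * ε} ⊆
      {z | δ (Matrix.of z.1) (faded X ρ (Matrix.of z.1) s + Matrix.of z.2) ≠ s} := by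
    rintro ⟨H, W⟩ ⟨hH, hW⟩ (hdec : δ (Matrix.of H) (faded X ρ (Matrix.of H) s + Matrix.of W) = s)
    have hml := hδ (Matrix.of H) (faded X ρ (Matrix.of H) s + Matrix.of W) s'
    rw [hdec, add_sub_cancel_left, faded_add_sub_faded] at hml
    refine absurd hml (not_le.2 ?_)
    have := hball (fun i j => (√ρ : ℂ) * H i j) W (fun i j => ?_) (fun i j => ?_)
    · refine lt_of_eq_of_lt ?_ this
      congr 2
      have he : Matrix.of (fun i j => (√ρ : ℂ) * H i j) = (√ρ : ℂ) • Matrix.of H := rfl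
      rw [he, hDdef, Matrix.mul_smul, Matrix.smul_mul, smul_smul, ← Complex.ofReal_mul,
        Real.sqrt_div hρ0.le, mul_one_div]
    · have h := hH i j
      have he : (√ρ : ℂ) * H i j - G i j =
          (√ρ : ℂ) * (H i j - ((1 / √ρ : ℝ) : ℂ) * G i j) := by
        rw [mul_sub, ← mul_assoc, ← Complex.ofReal_mul, mul_one_div_cancel hsq.ne']
        simp
      rw [he, norm_mul, Complex.norm_real, Real.norm_of_nonneg hsq.le]
      calc √ρ * _ < √ρ * (1 / √ρ * ε) := mul_lt_mul_of_pos_left h hsq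
        _ = ε := by field_simp
    · simpa using hW i j
  have hprod : c₁ * c₂ * ρ ^ (-((Fintype.card α * Fintype.card (Fin N) : ℕ) : ℝ)) ≤
      ((gaussianMatrix α (Fin N)).prod (gaussianMatrix τ (Fin N))).real
        {z | δ (Matrix.of z.1) (faded X ρ (Matrix.of z.1) s + Matrix.of z.2) ≠ s} := by
    refine le_trans ?_ (measureReal_mono hsub)
    rw [measureReal_prod_prod]
    have e1 := (ENNReal.ofReal_le_iff_le_toReal (measure_ne_top _ _)).1
      (h₁ (1 / √ρ) (by positivity) ht1)
    have e2 := (ENNReal.ofReal_le_iff_le_toReal (measure_ne_top _ _)).1 (h₂ 1 one_pos le_rfl)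
    rw [sq_inv_sqrt_pow hρ0] at e1
    rw [one_pow, mul_one] at e2
    calc _ = c₁ * ρ ^ (-((Fintype.card α * Fintype.card (Fin N) : ℕ) : ℝ)) * c₂ := by ring
      _ ≤ _ := mul_le_mul e1 e2 hc₂.le measureReal_nonneg
  rw [errorProb, div_mul_eq_mul_div]
  refine div_le_div_of_nonneg_right (hprod.trans ?_) hcard.le
  exact Finset.single_le_sum (f := fun s => ((gaussianMatrix α (Fin N)).prod
    (gaussianMatrix τ (Fin N))).real
      {z | δ (Matrix.of z.1) (faded X ρ (Matrix.of z.1) s + Matrix.of z.2) ≠ s})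
    (fun _ _ => measureReal_nonneg) (Finset.mem_univ s)

/-- The rank criterion implies full diversity under ML decoding. -/
theorem FullRank.fullDiversityML [Nonempty α] [Nontrivial S] (hN : 0 < N) (hX : FullRank X) :
    FullDiversityML X N := by
  refine ⟨fun δ hδ => ?_, hX⟩
  obtain ⟨K, hK⟩ := exists_errorProb_le (N := N) hX
  obtain ⟨c, hc, hcl⟩ := exists_le_errorProb hN hX
  have hd : ((Fintype.card α * Fintype.card (Fin N) : ℕ) : ℝ) = Fintype.card α * N := by
    rw [Fintype.card_fin]; push_cast; rfl
  rw [hd] at hK hcl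
  refine tendsto_neg_log_div_log hc ?_ (K := K) ?_
  · filter_upwards [eventually_ge_atTop 1] with ρ hρ
    exact hcl ρ hρ _ (hδ ρ (by linarith))
  · filter_upwards [eventually_gt_atTop 0] with ρ hρ
    exact hK ρ hρ _ (hδ ρ hρ)

end Code

theorem fullDiversityML_alamoutiBlock {M T P N : ℕ} (hM : Even M) (hM0 : 0 < M) (hT : Even T)
    (hMT : M ≤ T) (hP : P = (T - M) / 2 + 1) (hN : 0 < N) {A : Finset ℂ} (hA : A.Nontrivial)
    {Θ : Matrix (Fin (M / 2)) (Fin (M / 2)) ℂ} (hΘ : HasSignalSpaceDiversity A Θ) :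
    FullDiversityML (alamoutiBlock M T P A Θ) N := by
  obtain ⟨a, rfl⟩ := hM
  obtain ⟨b, rfl⟩ := hT
  have : Nontrivial A := by
    obtain ⟨x, hx, y, hy, hxy⟩ := hA
    exact ⟨⟨x, hx⟩, ⟨y, hy⟩, fun h => hxy (congrArg Subtype.val h)⟩
  have : Nonempty (Fin ((a + a) / 2)) := ⟨⟨0, by omega⟩⟩
  have : Nonempty (Fin P) := ⟨⟨0, by omega⟩⟩
  exact (fullRank_alamoutiBlock (by omega) hΘ).fullDiversityML hN

end STBC

end

theorem theorem1 (M T P N : ℕ) (hM : Even M) (hM0 : 0 < M) (hT : Even T) (hMT : M ≤ T)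
    (hP : P = (T - M) / 2 + 1) (hN : 0 < N) (A : Finset ℂ) (hA : A.Nontrivial) :
    (∀ Θ : Matrix (Fin (M / 2)) (Fin (M / 2)) ℂ, STBC.HasSignalSpaceDiversity A Θ →
      STBC.FullDiversityML (STBC.alamoutiBlock M T P A Θ) N) ∧
    (∀ (m n : ℕ) (ν : Fin (M / 2) → ℤ), STBC.CyclotomicParams (M / 2) m n ν →
      STBC.IsCyclotomicConstellation m A →
      STBC.FullDiversityML
        (STBC.alamoutiBlock M T P A (STBC.cyclotomicRotation (M / 2) m n ν)) N) := by
  have key := fun Θ hΘ =>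
    STBC.fullDiversityML_alamoutiBlock (Θ := Θ) hM hM0 hT hMT hP hN hA hΘ
  exact ⟨key, fun _ _ _ h hc => key _ (STBC.hasSignalSpaceDiversity_cyclotomicRotation h hc)⟩
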